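/- Let $d\ge 1$ and $m\ge 0$ be integers, $\|x\|=\max_i|x_i|$ on $\mathbb{Z}^d$. For $A\subset\mathbb{Z}^d$ and $N\in\mathbb{N}$ put $A_N=A\cap[-N,N]^d$ and, for $k\in\mathbb{Z}^d$, $$H_N(k;A)=\frac{\operatorname{card}\{A_N\cap(k+A_N)\}}{(2N+1)^d}.$$ Call $A$ asymptotically measurable (AM) if $H(k;A)=\lim_{N\to\infty}H_N(k;A)$ exists for every $k\in\mathbb{Z}^d$. For a real random field $X=(X_n)_{n\in\mathbb{Z}^d}$ put $$S_N(A,X)=(2N+1)^{-d/2}\sum_{n\in A_N}X_n,\qquad r^X(k)=E\{X_0X_k\},$$ $$X_n^{J}=X_n\mathbf 1_{\{|X_n|\le J\}}-E\{X_n\mathbf 1_{\{|X_n|\le J\}}\}\quad(J>0).$$ For each $N\in\mathbb{N}$ let $X^N=(X^N_n)_{n\in\mathbb{Z}^d}$ be a (strictly) stationary, centered real random field (possibly on a probability space depending on $N$) which is $m$-dependent, that is, $(X^N_a)_{a\in B}$ and $(X^N_{b})_{b\in B'}$ are independent whenever $B,B'\subset\mathbb{Z}^d$ satisfy $\|a-b\|>m$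 for all $a\in B$, $b\in B'$; here $m$ does not depend on $N$. Write $X^{N,J}=(X^N)^J$. Assume: 1. there is a constant $\mathcal{C}>0$ such that $E\{(X^N_0)^4\}<\mathcal{C}$ for all $N$; 2. there are numbers $\rho(k)$ such that $|r^{X^N}(k)|\le\rho(k)$ for all $N$ and all $k\in\mathbb{Z}^d$ with $\|k\|\le m$; 3. for all $k\in\mathbb{Z}^d$ and all real $J>0$ there are real numbers $\gamma^J(k)$ and $\gamma(k)$ with $$\lim_{N\to\infty}r^{X^{N,J}}(k)=\gamma^J(k)\qquad\text{and}\qquad\lim_{J\to+\infty}\gamma^J(k)=\gamma(k).$$ Then for every AM set $A\subset\mathbb{Z}^d$ the number $$\sigma^2(A)=\sum_{k\in\mathbb{Z}^d,\ \|k\|\le m}\gamma(k)\,H(k;A)$$ is nonnegative, and $S_N(A,X^N)$ converges weakly, as $N\to\infty$, to $N(0,\sigma^2(A))$ (the point mass at $0$ if $\sigma^2(A)=0$). -/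

import Mathlib

open MeasureTheory ProbabilityTheory Filter Topology

/-- The cube `[-N, N]^d` of the lattice `ℤ^d`. -/
noncomputable def box (d N : ℕ) : Finset (Fin d → ℤ) :=
  Finset.Icc (fun _ => -(N : ℤ)) (fun _ => (N : ℤ))

/-- The cube is the closed ball of radius `N` for the maximum norm, the norm of `Fin d → ℤ`. -/
theorem mem_box_iff_norm_le {d N : ℕ} (k : Fin d → ℤ) : k ∈ box d N ↔ ‖k‖ ≤ (N : ℝ) := by
  rw [box, Finset.mem_Icc, pi_norm_le_iff_of_nonneg (Nat.cast_nonneg N), Pi.le_def, Pi.le_def,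
    ← forall_and]
  refine forall_congr' fun i => ?_
  rw [Int.norm_eq_abs, ← abs_le]
  exact_mod_cast Iff.rfl

open Classical in
/-- `A_N = A ∩ [-N, N]^d`. -/
noncomputable def window {d : ℕ} (N : ℕ) (A : Set (Fin d → ℤ)) : Finset (Fin d → ℤ) :=
  (box d N).filter (fun n => n ∈ A)

/-- `H_N(n; A) = card (A_N ∩ (n + A_N)) / (2N+1)^d`. -/
noncomputable def overlap {d : ℕ} (N : ℕ) (n : Fin d → ℤ) (A : Set (Fin d → ℤ)) : ℝ :=
  ((window N A ∩ (window N A).image (fun a => n + a)).card : ℝ) / (2 * (N : ℝ) + 1) ^ d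

/-- `A` is asymptotically measurable, with limits `H(n; A) = H n`: for every `n`, the sequence
`H_N(n; A)` converges to `H n`. (Then `0 ≤ H n ≤ 1`; no further restriction is put on `H`.) -/
def IsAsymptoticallyMeasurable {d : ℕ} (A : Set (Fin d → ℤ)) (H : (Fin d → ℤ) → ℝ) : Prop :=
  ∀ n : Fin d → ℤ, Tendsto (fun N : ℕ => overlap N n A) atTop (𝓝 (H n))

/-- `S_N(A, X) = (2N+1)^{-d/2} ∑_{n ∈ A_N} X_n`. -/
noncomputable def normalizedSum {d : ℕ} {Ω : Type*} (N : ℕ) (A : Set (Fin d → ℤ))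
    (X : (Fin d → ℤ) → Ω → ℝ) (ω : Ω) : ℝ :=
  (∑ n ∈ window N A, X n ω) / Real.sqrt ((2 * (N : ℝ) + 1) ^ d)

/-- A (strictly) stationary random field: its law, as a law on `ℝ^(ℤ^d)`, is invariant under
translations of the lattice. -/
def IsStationaryField {d : ℕ} {Ω : Type*} [MeasurableSpace Ω] (P : Measure Ω)
    (X : (Fin d → ℤ) → Ω → ℝ) : Prop :=
  ∀ h : Fin d → ℤ, IdentDistrib (fun ω n => X (n + h) ω) (fun ω n => X n ω) P P

/-- An `m`-dependent random field: the families `(X_a)_{a ∈ A}` and `(X_b)_{b ∈ B}` are independent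
for any sets of sites `A`, `B` whose distance in the maximum norm exceeds `m`. -/
def IsMDependentField {d : ℕ} {Ω : Type*} [MeasurableSpace Ω] (m : ℕ) (P : Measure Ω)
    (X : (Fin d → ℤ) → Ω → ℝ) : Prop :=
  ∀ A B : Set (Fin d → ℤ), (∀ a ∈ A, ∀ b ∈ B, (m : ℝ) < ‖a - b‖) →
    IndepFun (fun ω (a : A) => X a ω) (fun ω (b : B) => X b ω) P

/-- The function `r^X(k) = E(X_0 X_k)`. -/
noncomputable def fieldCov {d : ℕ} {Ω : Type*} [MeasurableSpace Ω] (P : Measure Ω)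
    (X : (Fin d → ℤ) → Ω → ℝ) (k : Fin d → ℤ) : ℝ :=
  ∫ ω, X 0 ω * X k ω ∂P

/-- `Y 1_{|Y| ≤ J}`. -/
noncomputable def cutoff {Ω : Type*} (J : ℝ) (Y : Ω → ℝ) : Ω → ℝ :=
  Set.indicator {ω | |Y ω| ≤ J} Y

/-- The centered truncation `X_n^J = X_n 1_{|X_n| ≤ J} - E(X_n 1_{|X_n| ≤ J})`. -/
noncomputable def truncatedField {d : ℕ} {Ω : Type*} [MeasurableSpace Ω] (P : Measure Ω) (J : ℝ)
    (X : (Fin d → ℤ) → Ω → ℝ) (n : Fin d → ℤ) (ω : Ω) : ℝ :=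
  cutoff J (X n) ω - ∫ ω', cutoff J (X n) ω' ∂P

/-! Fourth moments bounded uniformly in `N` make truncation change covariances by `O(1/J)` uniformly
in `N`, so the limits in `N` and `J` may be exchanged and `r^{X^N}(k) → γ(k)`. By `m`-dependence and
stationarity the variance of `S_N` is the sum of `r^{X^N}(k) H_N(k; A)` over `‖k‖ ≤ m`. It tends to
`σ²(A)`, which is therefore nonnegative.

Normality comes from the Stein–Tikhomirov method, applied to the untruncated field. Let `S` be the
unnormalized sum, `c = (2N+1)^{-d/2}`, and `T_a` the part of `S` within distance `m` of `a`. Since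
`X_a` is centered and independent of `S - T_a`, expanding the exponential gives `E X_a e^{itcS} ≈
itc E X_a T_a e^{itcS}`. The products `X_a T_a` are correlated only at distance at most `3m`, so
their sum may be replaced by its mean (`norm_integral_sum_mul_exp_sub_le`). Hence the characteristic
function solves `φ' = -v t φ` up to `O(c)`, where `v` is the variance of `cS`. An integrating factor
then gives `φ(t) = e^{-vt²/2} + O(c)` (`norm_integral_exp_sub_gaussian_le`), and Lévy's continuity
theorem concludes. -/

/-! ### Taylor and moment inequalities -/

theorem norm_exp_ofReal_mul_I_sub_one_sub_le (x : ℝ) :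
    ‖Complex.exp (x * Complex.I) - 1 - x * Complex.I‖ ≤ 2 * x ^ 2 := by
  have hx : ‖(x : ℂ) * Complex.I‖ = |x| := by simp
  rcases le_total |x| 1 with h | h
  · have := Complex.norm_exp_sub_one_sub_id_le (x := (x : ℂ) * Complex.I) (by rwa [hx])
    rw [hx, sq_abs] at this
    nlinarith [sq_nonneg x]
  · have h1 : ‖Complex.exp (x * Complex.I) - 1‖ ≤ |x| := by
      have := Real.norm_exp_I_mul_ofReal_sub_one_le (x := x)
      rwa [mul_comm, Real.norm_eq_abs] at this
    have h2 := norm_sub_le (Complex.exp (x * Complex.I) - 1) (x * Complex.I)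
    rw [hx] at h2
    nlinarith [sq_abs x]

section
variable {Ω : Type*} [MeasurableSpace Ω] {P : Measure Ω}

theorem MeasureTheory.MemLp.integrable_pow_four {Y : Ω → ℝ} (h : MemLp Y 4 P) :
    Integrable (fun ω => Y ω ^ 4) P := by
  have := h.integrable_norm_pow (p := 4) (by norm_num)
  refine this.congr (ae_of_all _ fun ω => ?_)
  simp only [Real.norm_eq_abs]
  rw [show (4 : ℕ) = 2 * 2 from rfl, pow_mul, sq_abs, ← pow_mul]

theorem MeasureTheory.MemLp.mul_memLp_two {Y Z : Ω → ℝ} (hY : MemLp Y 4 P) (hZ : MemLp Z 4 P) :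
    MemLp (fun ω => Y ω * Z ω) 2 P := by
  have : ENNReal.HolderTriple 4 4 2 := ⟨by
    rw [← two_mul, show (4 : ENNReal) = 2 * 2 by norm_num,
      ENNReal.mul_inv (by norm_num) (by norm_num), ← mul_assoc,
      ENNReal.mul_inv_cancel (by norm_num) (by norm_num), one_mul]⟩
  exact hZ.mul' hY

theorem integral_mul_sq_le_of_pow_four_le {Y Z : Ω → ℝ} {D : ℝ} (hY : MemLp Y 4 P)
    (hZ : MemLp Z 4 P) (hYD : ∫ ω, Y ω ^ 4 ∂P ≤ D) (hZD : ∫ ω, Z ω ^ 4 ∂P ≤ D) :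
    ∫ ω, (Y ω * Z ω) ^ 2 ∂P ≤ D := by
  have h := integral_mono (hY.mul_memLp_two hZ).integrable_sq
    ((hY.integrable_pow_four.add hZ.integrable_pow_four).div_const 2)
    (fun ω => show (Y ω * Z ω) ^ 2 ≤ (Y ω ^ 4 + Z ω ^ 4) / 2 by
      nlinarith [sq_nonneg (Y ω ^ 2 - Z ω ^ 2)])
  have h2 : ∫ ω, (Y ω ^ 4 + Z ω ^ 4) / 2 ∂P = (∫ ω, Y ω ^ 4 ∂P + ∫ ω, Z ω ^ 4 ∂P) / 2 := by
    rw [integral_div, integral_add hY.integrable_pow_four hZ.integrable_pow_four]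
  simp only [Pi.add_apply] at h
  linarith

theorem integrable_ofReal_mul_exp {Y S : Ω → ℝ} (hY : Integrable Y P) (hS : Measurable S) :
    Integrable (fun ω => (Y ω : ℂ) * Complex.exp (S ω * Complex.I)) P := by
  refine hY.ofReal.mul_bdd (c := 1) (by fun_prop) (ae_of_all _ fun ω => ?_)
  rw [Complex.norm_exp_ofReal_mul_I]

variable [IsProbabilityMeasure P]

theorem integrable_abs_mul_sq {Y Z : Ω → ℝ} (hY : MemLp Y 4 P) (hZ : MemLp Z 4 P) :
    Integrable (fun ω => |Y ω| * Z ω ^ 2) P := by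
  have hY2 : MemLp Y 2 P := hY.mono_exponent (by norm_num)
  have := (hZ.mul_memLp_two hZ).integrable_mul hY2.norm
  refine this.congr (ae_of_all _ fun ω => ?_)
  simp only [Pi.mul_apply, Real.norm_eq_abs]
  ring

theorem integral_abs_mul_sq_le {Y Z : Ω → ℝ} {D : ℝ} (hD : 1 ≤ D) (hY : MemLp Y 4 P)
    (hZ : MemLp Z 4 P) (hYD : ∫ ω, Y ω ^ 4 ∂P ≤ D) (hZD : ∫ ω, Z ω ^ 4 ∂P ≤ D) :
    ∫ ω, |Y ω| * Z ω ^ 2 ∂P ≤ D := by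
  have h := integral_mono (integrable_abs_mul_sq hY hZ)
    (((((integrable_const (1 : ℝ)).add hY.integrable_pow_four).div_const 2).add
      hZ.integrable_pow_four).div_const 2)
    (fun ω => show |Y ω| * Z ω ^ 2 ≤ ((1 + Y ω ^ 4) / 2 + Z ω ^ 4) / 2 by
      -- Two uses of AM-GM: `|Y| Z² ≤ (Y² + Z⁴)/2` and `Y² ≤ (1 + Y⁴)/2`. The constant `1` is later
      -- absorbed by `1 ≤ D`.
      nlinarith [sq_nonneg (|Y ω| - Z ω ^ 2), sq_nonneg (Y ω ^ 2 - 1), sq_abs (Y ω)])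
  have h2 : ∫ ω, ((1 + Y ω ^ 4) / 2 + Z ω ^ 4) / 2 ∂P
      = ((1 + ∫ ω, Y ω ^ 4 ∂P) / 2 + ∫ ω, Z ω ^ 4 ∂P) / 2 := by
    have i1 : Integrable (fun ω => 1 + Y ω ^ 4) P :=
      (integrable_const (1 : ℝ)).add hY.integrable_pow_four
    rw [integral_div, integral_add (i1.div_const 2) hZ.integrable_pow_four, integral_div,
      integral_add (integrable_const (1 : ℝ)) hY.integrable_pow_four]
    simp
  simp only [Pi.add_apply] at h
  linarith

/-- Expand `0 ≤ Var(Y - Z)` and bound each variance by the second moment. -/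
theorem covariance_le_of_sq_le {Y Z : Ω → ℝ} {D : ℝ} (hY : MemLp Y 2 P) (hZ : MemLp Z 2 P)
    (hYD : ∫ ω, Y ω ^ 2 ∂P ≤ D) (hZD : ∫ ω, Z ω ^ 2 ∂P ≤ D) : cov[Y, Z; P] ≤ D := by
  have h := variance_nonneg (Y - Z) P
  rw [variance_sub hY hZ, variance_eq_sub hY, variance_eq_sub hZ] at h
  simp only [Pi.pow_apply] at h
  nlinarith [sq_nonneg (∫ ω, Y ω ∂P), sq_nonneg (∫ ω, Z ω ∂P)]

theorem integral_abs_le_sqrt_of_sq_le {Y : Ω → ℝ} {V : ℝ} (hY : MemLp Y 2 P)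
    (h : ∫ ω, Y ω ^ 2 ∂P ≤ V) : ∫ ω, |Y ω| ∂P ≤ √V := by
  apply Real.le_sqrt_of_sq_le
  have h1 := variance_nonneg (fun ω => |Y ω|) P
  rw [variance_eq_sub (X := fun ω => |Y ω|) hY.norm] at h1
  simp only [Pi.pow_apply, sq_abs] at h1
  linarith

/-- If the covariances vanish outside a sparse graph, the variance of a sum is at most linear in
the number of terms. -/
theorem variance_sum_le_of_sparse {ι : Type*} [DecidableEq ι] {s : Finset ι} {Z : ι → Ω → ℝ}
    {D : ℝ} {K : ℕ} (nb : ι → Finset ι) (hD : 0 ≤ D) (hZ : ∀ a ∈ s, MemLp (Z a) 2 P)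
    (hZD : ∀ a ∈ s, ∫ ω, Z a ω ^ 2 ∂P ≤ D) (hK : ∀ a ∈ s, (nb a).card ≤ K)
    (hcov : ∀ a ∈ s, ∀ b ∈ s, b ∉ nb a → cov[Z a, Z b; P] = 0) :
    Var[∑ a ∈ s, Z a; P] ≤ s.card * (K * D) := by
  rw [variance_sum' hZ]
  calc ∑ a ∈ s, ∑ b ∈ s, cov[Z a, Z b; P] ≤ ∑ a ∈ s, (K * D : ℝ) := by
        refine Finset.sum_le_sum fun a ha => ?_
        calc ∑ b ∈ s, cov[Z a, Z b; P] ≤ ∑ b ∈ s, if b ∈ nb a then D else 0 := by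
              refine Finset.sum_le_sum fun b hb => ?_
              split_ifs with h
              · exact covariance_le_of_sq_le (hZ a ha) (hZ b hb) (hZD a ha) (hZD b hb)
              · exact (hcov a ha b hb h).le
          _ = ((s.filter (· ∈ nb a)).card : ℝ) * D := by
              rw [← Finset.sum_filter, Finset.sum_const, nsmul_eq_mul]
          _ ≤ K * D := by
              gcongr
              exact (Finset.card_le_card fun b hb => (Finset.mem_filter.1 hb).2).trans (hK a ha)
    _ = s.card * (K * D) := by rw [Finset.sum_const, nsmul_eq_mul]

/-! ### The Stein–Tikhomirov method -/

/-- Local step: `E (Y e^{iS})` is `i E (Y T e^{iS})` up to a second order error, when `Y` is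
centered and independent of `S - T`. -/
theorem norm_integral_mul_exp_sub_le {Y S T : Ω → ℝ} {D : ℝ} (θ : ℝ) (hD : 1 ≤ D)
    (hS : Measurable S) (hTm : Measurable T) (hYm : Measurable Y)
    (hY : MemLp Y 4 P) (hT : MemLp T 4 P)
    (hYD : ∫ ω, Y ω ^ 4 ∂P ≤ D) (hTD : ∫ ω, T ω ^ 4 ∂P ≤ D) (hmean : ∫ ω, Y ω ∂P = 0)
    (hind : IndepFun Y (fun ω => S ω - T ω) P) :
    ‖∫ ω, (Y ω : ℂ) * Complex.exp ((θ * S ω : ℝ) * Complex.I) ∂P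
      - θ * Complex.I * ∫ ω, ((Y ω * T ω : ℝ) : ℂ) * Complex.exp ((θ * S ω : ℝ) * Complex.I) ∂P‖
      ≤ 2 * θ ^ 2 * D := by
  have hY1 : Integrable Y P := hY.integrable (by norm_num)
  have hYT : Integrable (fun ω => Y ω * T ω) P := (hY.mul_memLp_two hT).integrable (by norm_num)
  have i1 := integrable_ofReal_mul_exp hY1 (hS.const_mul θ)
  have i2 := (integrable_ofReal_mul_exp hYT (hS.const_mul θ)).const_mul (θ * Complex.I)
  have i3 : Integrable (fun ω =>
      (Y ω : ℂ) * Complex.exp ((θ * (S ω - T ω) : ℝ) * Complex.I)) P :=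
    integrable_ofReal_mul_exp hY1 ((hS.sub hTm).const_mul θ)
  -- Independence factors this expectation, and the factor `E Y` vanishes; subtracting it leaves
  -- only the Taylor remainder of `e^{-iθT}`.
  have h0 : ∫ ω, (Y ω : ℂ) * Complex.exp ((θ * (S ω - T ω) : ℝ) * Complex.I) ∂P = 0 := by
    have hi := hind.comp (φ := fun x : ℝ => (x : ℂ))
      (ψ := fun x : ℝ => Complex.exp ((θ * x : ℝ) * Complex.I)) (by fun_prop) (by fun_prop)
    have := hi.integral_fun_mul_eq_mul_integral
      (Complex.measurable_ofReal.comp hYm).aestronglyMeasurable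
      (Measurable.aestronglyMeasurable (by fun_prop))
    simp only [Function.comp_apply] at this
    rw [this, integral_complex_ofReal, hmean]
    simp
  rw [← integral_const_mul, ← integral_sub i1 i2]
  have i12 := i1.sub i2
  simp only [Pi.sub_def] at i12
  rw [← sub_zero (∫ ω, _ ∂P), ← h0, ← integral_sub i12 i3]
  have hb : 2 * θ ^ 2 * ∫ ω, |Y ω| * T ω ^ 2 ∂P ≤ 2 * θ ^ 2 * D := by
    gcongr
    exact integral_abs_mul_sq_le hD hY hT hYD hTD
  refine le_trans ?_ hb
  rw [← integral_const_mul]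
  refine norm_integral_le_of_norm_le ((integrable_abs_mul_sq hY hT).const_mul _)
    (ae_of_all _ fun ω => ?_)
  have e : (Y ω : ℂ) * Complex.exp ((θ * S ω : ℝ) * Complex.I)
      - θ * Complex.I * (((Y ω * T ω : ℝ) : ℂ) * Complex.exp ((θ * S ω : ℝ) * Complex.I))
      - (Y ω : ℂ) * Complex.exp ((θ * (S ω - T ω) : ℝ) * Complex.I)
      = -((Y ω : ℂ) * Complex.exp ((θ * S ω : ℝ) * Complex.I) *
        (Complex.exp (((-(θ * T ω) : ℝ) : ℂ) * Complex.I) - 1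
          - ((-(θ * T ω) : ℝ) : ℂ) * Complex.I)) := by
    have : Complex.exp ((θ * (S ω - T ω) : ℝ) * Complex.I)
        = Complex.exp ((θ * S ω : ℝ) * Complex.I) *
          Complex.exp (((-(θ * T ω) : ℝ) : ℂ) * Complex.I) := by
      rw [← Complex.exp_add]; congr 1; push_cast; ring
    rw [this]; push_cast; ring
  rw [e, norm_neg, norm_mul, norm_mul, Complex.norm_exp_ofReal_mul_I, Complex.norm_real,
    Real.norm_eq_abs, mul_one]
  have := norm_exp_ofReal_mul_I_sub_one_sub_le (-(θ * T ω))
  calc _ ≤ |Y ω| * (2 * (-(θ * T ω)) ^ 2) := by gcongr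
    _ = _ := by ring

/-- The Stein–Tikhomirov estimate for a sum with dependency neighbourhoods `nb a` (on which
`T a` is the sum) and second order neighbourhoods `nb' a`. -/
theorem norm_integral_sum_mul_exp_sub_le {ι : Type*} [DecidableEq ι] {s : Finset ι}
    {X T : ι → Ω → ℝ} {D c : ℝ} {K : ℕ} (nb : ι → Finset ι) (t : ℝ) (hD : 1 ≤ D)
    (hc : 0 ≤ c) (hcs : c ^ 2 * s.card ≤ 1)
    (hXm : ∀ a, Measurable (X a)) (hTm : ∀ a, Measurable (T a))
    (hX : ∀ a, MemLp (X a) 4 P) (hT : ∀ a, MemLp (T a) 4 P)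
    (hXD : ∀ a, ∫ ω, X a ω ^ 4 ∂P ≤ D) (hTD : ∀ a, ∫ ω, T a ω ^ 4 ∂P ≤ D)
    (hmean : ∀ a, ∫ ω, X a ω ∂P = 0)
    (hind : ∀ a ∈ s, IndepFun (X a) (fun ω => ∑ b ∈ s, X b ω - T a ω) P)
    (hK : ∀ a ∈ s, (nb a).card ≤ K)
    (hcov : ∀ a ∈ s, ∀ b ∈ s, b ∉ nb a →
      cov[fun ω => X a ω * T a ω, fun ω => X b ω * T b ω; P] = 0) :
    ‖∫ ω, ((c * ∑ a ∈ s, X a ω : ℝ) : ℂ)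
          * Complex.exp ((t * (c * ∑ a ∈ s, X a ω) : ℝ) * Complex.I) ∂P
      - t * Complex.I * (c ^ 2 * ∑ a ∈ s, ∫ ω, X a ω * T a ω ∂P : ℝ)
        * ∫ ω, Complex.exp ((t * (c * ∑ a ∈ s, X a ω) : ℝ) * Complex.I) ∂P‖
      ≤ c * (2 * t ^ 2 * D + |t| * √(K * D)) := by
  set S : Ω → ℝ := fun ω => ∑ a ∈ s, X a ω with hSdef
  have hSm : Measurable S := by fun_prop
  have hX1 : ∀ a, Integrable (X a) P := fun a => (hX a).integrable (by norm_num)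
  set Z : ι → Ω → ℝ := fun a ω => X a ω * T a ω
  have hZ2 : ∀ a, MemLp (Z a) 2 P := fun a => (hX a).mul_memLp_two (hT a)
  have hZ1 : ∀ a, Integrable (Z a) P := fun a => (hZ2 a).integrable (by norm_num)
  -- `S` is not normalized here, so the frequency is `t * c`.
  set E : Ω → ℂ := fun ω => Complex.exp ((t * c * S ω : ℝ) * Complex.I) with hEdef
  have hEm : Measurable E := by fun_prop
  have hE1 : ∀ ω, ‖E ω‖ = 1 := fun ω => Complex.norm_exp_ofReal_mul_I _
  have hEi : Integrable E P := Integrable.of_bound hEm.aestronglyMeasurable 1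
    (ae_of_all _ fun ω => (hE1 ω).le)
  have e0 : ∀ ω, Complex.exp ((t * (c * S ω) : ℝ) * Complex.I) = E ω := fun ω => by
    simp only [hEdef, mul_assoc]
  set μ : ℝ := ∑ a ∈ s, ∫ ω, Z a ω ∂P with hμ
  have hXE : ∀ a, Integrable (fun ω => (X a ω : ℂ) * E ω) P := fun a =>
    integrable_ofReal_mul_exp (hX1 a) (hSm.const_mul _)
  have hZE : ∀ a, Integrable (fun ω => (Z a ω : ℂ) * E ω) P := fun a =>
    integrable_ofReal_mul_exp (hZ1 a) (hSm.const_mul _)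
  have e1 : ∫ ω, ((c * S ω : ℝ) : ℂ) * E ω ∂P = c * ∑ a ∈ s, ∫ ω, (X a ω : ℂ) * E ω ∂P := by
    rw [← integral_finsetSum _ fun a _ => hXE a, ← integral_const_mul]
    refine integral_congr_ae (ae_of_all _ fun ω => ?_)
    simp only [hSdef]
    push_cast
    rw [Finset.mul_sum, Finset.mul_sum, Finset.sum_mul]
    exact Finset.sum_congr rfl fun a _ => by ring
  set Q : Ω → ℝ := ∑ a ∈ s, Z a with hQ
  have hQ2 : MemLp Q 2 P := memLp_finsetSum' _ fun a _ => hZ2 a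
  have hμQ : P[Q] = μ := by
    simp only [hQ, hμ, Finset.sum_apply]
    exact integral_finsetSum _ fun a _ => hZ1 a
  have hQE : Integrable (fun ω => (Q ω : ℂ) * E ω) P :=
    integrable_ofReal_mul_exp (hQ2.integrable (by norm_num)) (hSm.const_mul _)
  have e2 : ∫ ω, (Q ω : ℂ) * E ω ∂P = ∑ a ∈ s, ∫ ω, (Z a ω : ℂ) * E ω ∂P := by
    rw [← integral_finsetSum _ fun a _ => hZE a]
    refine integral_congr_ae (ae_of_all _ fun ω => ?_)
    simp only [hQ, Finset.sum_apply]
    push_cast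
    rw [Finset.sum_mul]
  have hloc : ∀ a ∈ s, ‖∫ ω, (X a ω : ℂ) * E ω ∂P
      - ((t * c : ℝ) : ℂ) * Complex.I * ∫ ω, (Z a ω : ℂ) * E ω ∂P‖ ≤ 2 * (t * c) ^ 2 * D :=
    fun a ha => norm_integral_mul_exp_sub_le (t * c) hD hSm (hTm a) (hXm a) (hX a) (hT a)
      (hXD a) (hTD a) (hmean a) (hind a ha)
  -- The fluctuation of `Q` is of order `√card s` because its summands are sparsely correlated.
  have hvar : ∫ ω, |Q ω - μ| ∂P ≤ √(s.card * (K * D)) := by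
    refine integral_abs_le_sqrt_of_sq_le (hQ2.sub (memLp_const μ)) ?_
    have := variance_sum_le_of_sparse nb (zero_le_one.trans hD) (fun a _ => hZ2 a)
      (fun a _ => integral_mul_sq_le_of_pow_four_le (hX a) (hT a) (hXD a) (hTD a)) hK hcov
    rw [variance_eq_integral hQ2.1.aemeasurable, hμQ] at this
    exact this
  have hfluct : ‖∫ ω, (Q ω : ℂ) * E ω ∂P - μ * ∫ ω, E ω ∂P‖ ≤ √(s.card * (K * D)) := by
    rw [← integral_const_mul, ← integral_sub hQE (hEi.const_mul _)]
    refine (norm_integral_le_of_norm_le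
      ((hQ2.sub (memLp_const μ)).integrable (by norm_num)).abs (ae_of_all _ fun ω => ?_)).trans hvar
    rw [← sub_mul, norm_mul, hE1, mul_one, ← Complex.ofReal_sub, Complex.norm_real,
      Real.norm_eq_abs]
    rfl
  change ‖∫ ω, ((c * S ω : ℝ) : ℂ) * Complex.exp ((t * (c * S ω) : ℝ) * Complex.I) ∂P
    - t * Complex.I * (c ^ 2 * μ : ℝ)
      * ∫ ω, Complex.exp ((t * (c * S ω) : ℝ) * Complex.I) ∂P‖ ≤ _
  simp only [e0]
  rw [e1]
  -- Two errors: the local Taylor errors, and the replacement of `Q` by its mean `μ`. Each is `O(c)`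
  -- because `c² * card s ≤ 1`.
  have split : (c : ℂ) * ∑ a ∈ s, ∫ ω, (X a ω : ℂ) * E ω ∂P
      - t * Complex.I * (c ^ 2 * μ : ℝ) * ∫ ω, E ω ∂P
      = c * ∑ a ∈ s, (∫ ω, (X a ω : ℂ) * E ω ∂P
        - ((t * c : ℝ) : ℂ) * Complex.I * ∫ ω, (Z a ω : ℂ) * E ω ∂P)
      + t * Complex.I * c ^ 2 * (∫ ω, (Q ω : ℂ) * E ω ∂P - μ * ∫ ω, E ω ∂P) := by
    rw [Finset.sum_sub_distrib, ← Finset.mul_sum, e2]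
    push_cast
    ring
  rw [split]
  refine (norm_add_le _ _).trans ?_
  rw [mul_add]
  refine add_le_add ?_ ?_
  · rw [norm_mul, Complex.norm_real, Real.norm_eq_abs, abs_of_nonneg hc]
    refine mul_le_mul_of_nonneg_left ((norm_sum_le_of_le s hloc).trans ?_) hc
    rw [Finset.sum_const, nsmul_eq_mul]
    calc (s.card : ℝ) * (2 * (t * c) ^ 2 * D) = (c ^ 2 * s.card) * (2 * t ^ 2 * D) := by ring
      _ ≤ 1 * (2 * t ^ 2 * D) := by gcongr
      _ = _ := one_mul _
  · rw [norm_mul, norm_mul, norm_mul, norm_pow, Complex.norm_I, Complex.norm_real,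
      Complex.norm_real, Real.norm_eq_abs, Real.norm_eq_abs, abs_of_nonneg hc, mul_one]
    have h2 : c * √(s.card * (K * D)) ≤ √(K * D) := by
      rw [← Real.sqrt_sq hc, ← Real.sqrt_mul (sq_nonneg c), ← mul_assoc]
      apply Real.sqrt_le_sqrt
      have : 0 ≤ (K : ℝ) * D := by positivity
      nlinarith
    calc |t| * c ^ 2 * ‖_‖ ≤ |t| * c ^ 2 * √(s.card * (K * D)) := by gcongr
      _ = c * (|t| * (c * √(s.card * (K * D)))) := by ring
      _ ≤ _ := by gcongr

/-- A characteristic function which almost solves `φ' = - v t φ` is almost Gaussian. -/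
theorem norm_integral_exp_sub_gaussian_le {S : Ω → ℝ} {v c D R : ℝ} (hSm : Measurable S)
    (hS : Integrable S P) (hv : 0 ≤ v) (hc : 0 ≤ c) (hD : 0 ≤ D) (hR : 0 ≤ R)
    (h : ∀ t : ℝ, ‖∫ ω, (S ω : ℂ) * Complex.exp ((t * S ω : ℝ) * Complex.I) ∂P
      - t * Complex.I * (v : ℂ) * ∫ ω, Complex.exp ((t * S ω : ℝ) * Complex.I) ∂P‖
      ≤ c * (2 * t ^ 2 * D + |t| * R)) (t : ℝ) :
    ‖∫ ω, Complex.exp ((t * S ω : ℝ) * Complex.I) ∂P - Complex.exp (-(v * t ^ 2 / 2 : ℝ))‖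
      ≤ c * ((2 * t ^ 2 * D + |t| * R) * Real.exp (v * t ^ 2 / 2) * |t|) := by
  set φ : ℝ → ℂ := fun t => ∫ ω, Complex.exp ((t * S ω : ℝ) * Complex.I) ∂P with hφ
  set ψ : ℝ → ℂ := fun t => ∫ ω, (S ω : ℂ) * Complex.exp ((t * S ω : ℝ) * Complex.I) ∂P with hψ
  have hder : ∀ u, HasDerivAt φ (Complex.I * ψ u) u := by
    intro u
    have := (hasDerivAt_integral_of_dominated_loc_of_deriv_le (μ := P) (x₀ := u)
      (s := Set.univ) (F := fun (t : ℝ) ω => Complex.exp ((t * S ω : ℝ) * Complex.I))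
      (F' := fun (t : ℝ) ω => Complex.I * ((S ω : ℂ) * Complex.exp ((t * S ω : ℝ) * Complex.I)))
      (bound := fun ω => |S ω|) Filter.univ_mem
      (Eventually.of_forall fun t => Measurable.aestronglyMeasurable (by fun_prop))
      (Integrable.of_bound (Measurable.aestronglyMeasurable (by fun_prop)) 1
        (ae_of_all _ fun ω => (Complex.norm_exp_ofReal_mul_I _).le))
      (Measurable.aestronglyMeasurable (by fun_prop))
      (ae_of_all _ fun ω t _ => by
        rw [norm_mul, norm_mul, Complex.norm_exp_ofReal_mul_I, Complex.norm_I, Complex.norm_real,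
          Real.norm_eq_abs, one_mul, mul_one])
      hS.abs (ae_of_all _ fun ω t _ => ?_)).2
    · rw [integral_const_mul] at this
      exact this
    · have h1 : HasDerivAt (fun t : ℝ => ((t * S ω : ℝ) : ℂ) * Complex.I)
          ((1 * S ω : ℝ) * Complex.I) t :=
        (((hasDerivAt_id t).mul_const (S ω)).ofReal_comp).mul_const _
      refine h1.cexp.congr_deriv ?_
      push_cast
      ring
  -- Integrating factor: the derivative of `φ * g` is the defect in the differential equation times
  -- `g`, so the mean value inequality on `[0, t]` controls `φ t * g t - 1`.
  set g : ℝ → ℂ := fun u => (Real.exp (v * u ^ 2 / 2) : ℂ) with hg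
  have hgd : ∀ u, HasDerivAt g ((Real.exp (v * u ^ 2 / 2) * (v * u) : ℝ) : ℂ) u := by
    intro u
    have h1 : HasDerivAt (fun u : ℝ => v * u ^ 2 / 2) (v * u) u := by
      have := ((hasDerivAt_pow 2 u).const_mul v).div_const 2
      refine this.congr_deriv ?_
      push_cast
      ring
    exact h1.exp.ofReal_comp
  have hfd : ∀ u ∈ segment ℝ 0 t, HasDerivWithinAt (fun u => φ u * g u)
      (Complex.I * (ψ u - u * Complex.I * v * φ u) * g u) (segment ℝ 0 t) u := by
    intro u _
    refine (((hder u).mul (hgd u)).congr_deriv ?_).hasDerivWithinAt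
    simp only [hg]
    push_cast
    linear_combination (u * v * φ u * Complex.exp (v * u ^ 2 / 2) : ℂ) * Complex.I_sq
  have hbound : ∀ u ∈ segment ℝ 0 t, ‖Complex.I * (ψ u - u * Complex.I * v * φ u) * g u‖
      ≤ c * (2 * t ^ 2 * D + |t| * R) * Real.exp (v * t ^ 2 / 2) := by
    intro u hu
    have hut : |u| ≤ |t| := by
      rw [segment_eq_uIcc] at hu
      have := Set.abs_sub_left_of_mem_uIcc hu
      simpa using this
    have hut2 : u ^ 2 ≤ t ^ 2 := sq_le_sq.2 hut
    rw [norm_mul, norm_mul, Complex.norm_I, one_mul]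
    simp only [hg]
    rw [Complex.norm_real, Real.norm_eq_abs, Real.abs_exp]
    refine mul_le_mul ((h u).trans ?_) ?_ (Real.exp_nonneg _) (by positivity)
    · gcongr
    · gcongr
  have key := (convex_segment (0 : ℝ) t).norm_image_sub_le_of_norm_hasDerivWithin_le hfd hbound
    (left_mem_segment ℝ 0 t) (right_mem_segment ℝ 0 t)
  have h0 : φ 0 * g 0 = 1 := by simp [hφ, hg]
  rw [h0, sub_zero, Real.norm_eq_abs] at key
  have e : φ t - Complex.exp (-(v * t ^ 2 / 2 : ℝ))
      = (φ t * g t - 1) * Complex.exp (-(v * t ^ 2 / 2 : ℝ)) := by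
    have : g t * Complex.exp (-(v * t ^ 2 / 2 : ℝ)) = 1 := by
      simp only [hg]
      rw [Complex.ofReal_exp, ← Complex.exp_add]
      simp
    rw [sub_mul, mul_assoc, this]; ring
  rw [e, norm_mul, ← Complex.ofReal_neg, Complex.norm_exp_ofReal]
  calc _ ≤ ‖φ t * g t - 1‖ * 1 := by
        gcongr
        rw [Real.exp_le_one_iff, neg_nonpos]
        positivity
    _ ≤ _ := by rw [mul_one]; refine key.trans (le_of_eq (by ring))
end

/-! ### Cubes and local sums -/

theorem notMem_box_iff {d N : ℕ} (k : Fin d → ℤ) : k ∉ box d N ↔ (N : ℝ) < ‖k‖ := by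
  rw [mem_box_iff_norm_le, not_le]

theorem zero_mem_box (d N : ℕ) : (0 : Fin d → ℤ) ∈ box d N := by
  rw [mem_box_iff_norm_le, norm_zero]
  positivity

theorem card_box (d N : ℕ) : ((box d N).card : ℝ) = (2 * (N : ℝ) + 1) ^ d := by
  rw [box, Pi.card_Icc]
  have : (((N : ℤ) + 1 - -(N : ℤ)).toNat : ℝ) = 2 * (N : ℝ) + 1 := by
    have h : ((N : ℤ) + 1 - -(N : ℤ)).toNat = 2 * N + 1 := by omega
    rw [h]; push_cast; ring
  simp only [Int.card_Icc, Finset.prod_const, Finset.card_univ, Fintype.card_fin]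
  rw [Nat.cast_pow, this]

open Classical in
/-- The sum of the field over the sites of `s` at distance at most `m` from `a`. -/
noncomputable def localSum {d : ℕ} {Ω : Type*} (m : ℕ) (s : Finset (Fin d → ℤ))
    (X : (Fin d → ℤ) → Ω → ℝ) (a : Fin d → ℤ) (ω : Ω) : ℝ :=
  ∑ b ∈ s.filter (fun b => b - a ∈ box d m), X b ω

open Classical in
theorem sum_sub_localSum {d m : ℕ} {Ω : Type*} {X : (Fin d → ℤ) → Ω → ℝ}
    (s : Finset (Fin d → ℤ)) (a : Fin d → ℤ) (ω : Ω) :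
    ∑ b ∈ s, X b ω - localSum m s X a ω = ∑ b ∈ s.filter (fun b => b - a ∉ box d m), X b ω := by
  rw [localSum, ← Finset.sum_filter_add_sum_filter_not s (fun b => b - a ∈ box d m)]
  ring

section
variable {d m : ℕ} {Ω : Type*} [MeasurableSpace Ω] {P : Measure Ω}
  {X : (Fin d → ℤ) → Ω → ℝ}

theorem measurable_localSum (hX : ∀ n, Measurable (X n)) (s : Finset (Fin d → ℤ))
    (a : Fin d → ℤ) : Measurable (localSum m s X a) := by
  unfold localSum
  fun_prop

theorem memLp_localSum {p : ENNReal} (hX : ∀ n, MemLp (X n) p P) (s : Finset (Fin d → ℤ))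
    (a : Fin d → ℤ) : MemLp (localSum m s X a) p P :=
  memLp_finsetSum _ fun b _ => hX b

theorem card_localSum_le (s : Finset (Fin d → ℤ)) (a : Fin d → ℤ) :
    (s.filter (fun b => b - a ∈ box d m)).card ≤ (box d m).card :=
  Finset.card_le_card_of_injOn (fun b => b - a)
    (fun b hb => by simpa using (Finset.mem_filter.1 hb).2)
    (fun b _ c _ h => by simpa using h)

theorem integral_localSum_pow_four_le {C : ℝ} (hX : ∀ n, MemLp (X n) 4 P)
    (hC : ∀ n, ∫ ω, X n ω ^ 4 ∂P ≤ C) (hC0 : 0 ≤ C) (s : Finset (Fin d → ℤ)) (a : Fin d → ℤ) :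
    ∫ ω, localSum m s X a ω ^ 4 ∂P ≤ (box d m).card ^ 4 * C := by
  set u := s.filter (fun b => b - a ∈ box d m) with hu
  have hcard : (u.card : ℝ) ≤ (box d m).card := by exact_mod_cast card_localSum_le s a
  have h4 : ∀ x : ℝ, |x| ^ 4 = x ^ 4 := fun x => by
    rw [show (4 : ℕ) = 2 * 2 from rfl, pow_mul, sq_abs, ← pow_mul]
  have hint : ∀ b ∈ u, Integrable (fun ω => X b ω ^ 4) P := fun b _ => (hX b).integrable_pow_four
  calc ∫ ω, localSum m s X a ω ^ 4 ∂P ≤ ∫ ω, (u.card : ℝ) ^ 3 * ∑ b ∈ u, X b ω ^ 4 ∂P := by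
        refine integral_mono (memLp_localSum hX s a).integrable_pow_four
          ((integrable_finsetSum _ hint).const_mul _) fun ω => ?_
        -- Power mean inequality with exponent 4.
        have h1 := pow_sum_le_card_mul_sum_pow (s := u) (f := fun b => |X b ω|)
          (fun _ _ => abs_nonneg _) 3
        simp only [Nat.reduceAdd, h4] at h1
        refine le_trans ?_ h1
        rw [← h4]
        gcongr
        exact Finset.abs_sum_le_sum_abs _ _
    _ = (u.card : ℝ) ^ 3 * ∑ b ∈ u, ∫ ω, X b ω ^ 4 ∂P := by
        rw [integral_const_mul, integral_finsetSum _ hint]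
    _ ≤ (u.card : ℝ) ^ 3 * (u.card * C) := by
        gcongr
        rw [← nsmul_eq_mul]
        exact Finset.sum_le_card_nsmul _ _ _ fun b _ => hC b
    _ = u.card ^ 4 * C := by ring
    _ ≤ _ := by gcongr

/-! ### Consequences of `m`-dependence and stationarity -/

theorem IsMDependentField.indepFun_comp {A B : Set (Fin d → ℤ)} (h : IsMDependentField m P X)
    (hAB : ∀ a ∈ A, ∀ b ∈ B, (m : ℝ) < ‖a - b‖) {f : (A → ℝ) → ℝ} {g : (B → ℝ) → ℝ}
    (hf : Measurable f) (hg : Measurable g) :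
    IndepFun (fun ω => f fun a : A => X a ω) (fun ω => g fun b : B => X b ω) P :=
  (h A B hAB).comp hf hg

theorem IsMDependentField.indepFun_sub_localSum (h : IsMDependentField m P X)
    (s : Finset (Fin d → ℤ)) (a : Fin d → ℤ) :
    IndepFun (X a) (fun ω => ∑ b ∈ s, X b ω - localSum m s X a ω) P := by
  classical
  simp only [sum_sub_localSum]
  set B : Set (Fin d → ℤ) := {b | b - a ∉ box d m} with hB
  have := h.indepFun_comp (A := {a}) (B := B) ?_
    (f := fun x => x ⟨a, rfl⟩)
    (g := fun y => ∑ b ∈ (s.filter (fun b => b - a ∉ box d m)).subtype (· ∈ B), y b)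
    (by fun_prop) (by fun_prop)
  · convert this using 1
    funext ω
    exact (Finset.sum_subtype_of_mem (fun b => X b ω) fun b hb => (Finset.mem_filter.1 hb).2).symm
  · rintro _ rfl b hb
    rwa [norm_sub_rev, ← notMem_box_iff]

/-- Each product depends only on the sites of a ball of radius `m`. Centers more than `3m` apart
leave the two balls more than `m` apart. -/
theorem IsMDependentField.indepFun_mul_localSum (h : IsMDependentField m P X)
    (s : Finset (Fin d → ℤ)) {a c : Fin d → ℤ} (hac : c - a ∉ box d (3 * m)) :
    IndepFun (fun ω => X a ω * localSum m s X a ω) (fun ω => X c ω * localSum m s X c ω) P := by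
  classical
  let B : (Fin d → ℤ) → Set (Fin d → ℤ) := fun a => {b | b - a ∈ box d m}
  let f : ∀ a, (B a → ℝ) → ℝ := fun a x => x ⟨a, by simp [B, zero_mem_box]⟩ *
    ∑ b ∈ (s.filter (fun b => b - a ∈ box d m)).subtype (· ∈ B a), x b
  have hf : ∀ a, Measurable (f a) := fun a => by fun_prop
  have e : ∀ a ω, f a (fun b : B a => X b ω) = X a ω * localSum m s X a ω := fun a ω => by
    simp only [f, localSum]
    congr 1
    exact Finset.sum_subtype_of_mem (fun b => X b ω) fun b hb => (Finset.mem_filter.1 hb).2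
  have := h.indepFun_comp (A := B a) (B := B c) ?_ (hf a) (hf c)
  · simpa only [e] using this
  · intro x hx y hy
    simp only [B, Set.mem_ofPred_eq, mem_box_iff_norm_le] at hx hy
    rw [notMem_box_iff] at hac
    push_cast at hac
    have h1 : ‖c - a‖ ≤ ‖y - c‖ + ‖x - y‖ + ‖x - a‖ := by
      calc ‖c - a‖ = ‖-(y - c) + -(x - y) + (x - a)‖ := by congr 1; abel
        _ ≤ ‖-(y - c)‖ + ‖-(x - y)‖ + ‖x - a‖ := norm_add₃_le
        _ = _ := by rw [norm_neg, norm_neg]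
    linarith

theorem IsMDependentField.integral_mul_eq_zero (h : IsMDependentField m P X)
    (hX : ∀ n, Measurable (X n)) (hcent : ∀ n, ∫ ω, X n ω ∂P = 0) {a b : Fin d → ℤ}
    (hab : b - a ∉ box d m) : ∫ ω, X a ω * X b ω ∂P = 0 := by
  have := h.indepFun_comp (A := {a}) (B := {b}) ?_ (f := fun x => x ⟨a, rfl⟩)
    (g := fun x => x ⟨b, rfl⟩) (by fun_prop) (by fun_prop)
  · rw [this.integral_fun_mul_eq_mul_integral (hX a).aestronglyMeasurable
      (hX b).aestronglyMeasurable, hcent, zero_mul]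
  · rintro _ rfl _ rfl
    rwa [norm_sub_rev, ← notMem_box_iff]

theorem IsStationaryField.identDistrib (h : IsStationaryField P X) (a : Fin d → ℤ) :
    IdentDistrib (X a) (X 0) P P := by
  simpa [Function.comp_def] using (h a).comp (measurable_pi_apply 0)

theorem IsStationaryField.identDistrib_prod (h : IsStationaryField P X) (a b : Fin d → ℤ) :
    IdentDistrib (fun ω => (X a ω, X b ω)) (fun ω => (X 0 ω, X (b - a) ω)) P P := by
  simpa [Function.comp_def] using (h a).comp
    ((measurable_pi_apply 0).prodMk (measurable_pi_apply (b - a)))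

theorem IsStationaryField.integral_mul (h : IsStationaryField P X) (a b : Fin d → ℤ) :
    ∫ ω, X a ω * X b ω ∂P = fieldCov P X (b - a) :=
  ((h.identDistrib_prod a b).comp (measurable_fst.mul measurable_snd)).integral_eq

theorem integral_mul_localSum (hX : ∀ n, MemLp (X n) 2 P)
    (h : IsStationaryField P X)
    (s : Finset (Fin d → ℤ)) (a : Fin d → ℤ) : ∫ ω, X a ω * localSum m s X a ω ∂P
      = ∑ k ∈ box d m, if a + k ∈ s then fieldCov P X k else 0 := by
  classical
  have hint : ∀ b, Integrable (fun ω => X a ω * X b ω) P := fun b => (hX a).integrable_mul (hX b)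
  simp only [localSum, Finset.mul_sum]
  rw [integral_finsetSum _ fun b _ => hint b]
  simp only [h.integral_mul]
  rw [← Finset.sum_filter]
  refine Finset.sum_nbij' (fun b => b - a) (fun k => a + k) ?_ ?_ ?_ ?_ ?_ <;>
    simp +contextual

/-- Group the pairs of sites by their difference `k`: the sites `a ∈ s` with `a + k ∈ s` are counted
by the overlap of `s` with its translate, the numerator of `H_N(k; A)`. -/
theorem sum_integral_mul_localSum (hX : ∀ n, MemLp (X n) 2 P)
    (h : IsStationaryField P X) (s : Finset (Fin d → ℤ)) :
    ∑ a ∈ s, ∫ ω, X a ω * localSum m s X a ω ∂P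
      = ∑ k ∈ box d m, fieldCov P X k * (s ∩ s.image (fun a => k + a)).card := by
  classical
  simp only [integral_mul_localSum hX h]
  rw [Finset.sum_comm]
  refine Finset.sum_congr rfl fun k _ => ?_
  rw [← Finset.sum_filter, Finset.sum_const, nsmul_eq_mul, mul_comm]
  congr 2
  refine Finset.card_nbij' (fun a => k + a) (fun b => b - k) ?_ ?_ ?_ ?_ <;>
    simp +contextual [Set.MapsTo, Set.LeftInvOn, sub_eq_add_neg, add_comm]

/-- The sum is the second moment of `∑ a ∈ s, X a`, since covariances at distance beyond `m` vanish.
-/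
theorem sum_integral_mul_localSum_nonneg (hX : ∀ n, MemLp (X n) 2 P)
    (hXm : ∀ n, Measurable (X n))
    (h : IsMDependentField m P X) (hcent : ∀ n, ∫ ω, X n ω ∂P = 0) (s : Finset (Fin d → ℤ)) :
    0 ≤ ∑ a ∈ s, ∫ ω, X a ω * localSum m s X a ω ∂P := by
  classical
  have hint : ∀ a b, Integrable (fun ω => X a ω * X b ω) P := fun a b =>
    (hX a).integrable_mul (hX b)
  have e : ∑ a ∈ s, ∫ ω, X a ω * localSum m s X a ω ∂P = ∫ ω, (∑ a ∈ s, X a ω) ^ 2 ∂P := by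
    simp only [sq, Finset.sum_mul_sum]
    rw [integral_finsetSum _ fun a _ => integrable_finsetSum _ fun b _ => hint a b]
    refine Finset.sum_congr rfl fun a _ => ?_
    simp only [localSum, Finset.mul_sum]
    rw [integral_finsetSum _ fun b _ => hint a b, integral_finsetSum _ fun b _ => hint a b,
      Finset.sum_filter]
    refine Finset.sum_congr rfl fun b _ => ?_
    split_ifs with hb
    · rfl
    · exact (h.integral_mul_eq_zero hXm hcent hb).symm
  rw [e]
  exact integral_nonneg fun ω => sq_nonneg _

/-- Quantitative Gaussian approximation of the normalized partial sums of an `m`-dependent field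
with bounded fourth moments. -/
theorem norm_integral_exp_sum_sub_gaussian_le [IsProbabilityMeasure P] {C c : ℝ}
    (hXm : ∀ n, Measurable (X n)) (hX : ∀ n, MemLp (X n) 4 P) (hC0 : 0 ≤ C)
    (hC : ∀ n, ∫ ω, X n ω ^ 4 ∂P ≤ C) (h : IsMDependentField m P X)
    (hcent : ∀ n, ∫ ω, X n ω ∂P = 0) (s : Finset (Fin d → ℤ)) (hc : 0 ≤ c)
    (hcs : c ^ 2 * s.card ≤ 1) (t : ℝ) :
    ‖∫ ω, Complex.exp ((t * (c * ∑ a ∈ s, X a ω) : ℝ) * Complex.I) ∂P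
        - Complex.exp (-((c ^ 2 * ∑ a ∈ s, ∫ ω, X a ω * localSum m s X a ω ∂P) * t ^ 2 / 2 : ℝ))‖
      ≤ c * ((2 * t ^ 2 * (1 + (box d m).card ^ 4 * C)
          + |t| * √((box d (3 * m)).card * (1 + (box d m).card ^ 4 * C)))
        * Real.exp ((c ^ 2 * ∑ a ∈ s, ∫ ω, X a ω * localSum m s X a ω ∂P) * t ^ 2 / 2) * |t|) := by
  classical
  have hX2 : ∀ n, MemLp (X n) 2 P := fun n => (hX n).mono_exponent (by norm_num)
  -- One bound for the fourth moments of both `X a` and its local sum; the added `1` secures `1 ≤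
  -- D`.
  set D : ℝ := 1 + (box d m).card ^ 4 * C with hDdef
  have hD : 1 ≤ D := le_add_of_nonneg_right (by positivity)
  have hT : ∀ a, MemLp (localSum m s X a) 4 P := memLp_localSum hX s
  have hK1 : (1 : ℝ) ≤ (box d m).card := by
    exact_mod_cast Finset.card_pos.2 ⟨0, zero_mem_box d m⟩
  refine norm_integral_exp_sub_gaussian_le (by fun_prop)
    ((integrable_finsetSum _ fun a _ => (hX a).integrable (by norm_num)).const_mul c)
    (mul_nonneg (sq_nonneg c) (sum_integral_mul_localSum_nonneg hX2 hXm h hcent s)) hc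
    (zero_le_one.trans hD) (Real.sqrt_nonneg _) (fun t => ?_) t
  refine norm_integral_sum_mul_exp_sub_le (fun a => (box d (3 * m)).image (fun k => a + k)) t hD hc
    hcs hXm (measurable_localSum hXm s) hX hT (fun a => (hC a).trans ?_) (fun a => ?_) hcent
    (fun a _ => h.indepFun_sub_localSum s a) (fun a _ => Finset.card_image_le) ?_
  · have : C ≤ (box d m).card ^ 4 * C := le_mul_of_one_le_left hC0 (one_le_pow₀ hK1)
    linarith
  · have := integral_localSum_pow_four_le (m := m) hX hC hC0 s a
    linarith
  · intro a _ b _ hb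
    have hb' : b - a ∉ box d (3 * m) := fun hk =>
      hb (Finset.mem_image.2 ⟨b - a, hk, add_sub_cancel a b⟩)
    exact (h.indepFun_mul_localSum s hb').covariance_eq_zero ((hX a).mul_memLp_two (hT a))
      ((hX b).mul_memLp_two (hT b))
end

/-! ### Truncation and covariances -/

theorem cutoff_apply {Ω : Type*} (J : ℝ) (Y : Ω → ℝ) (ω : Ω) :
    cutoff J Y ω = if |Y ω| ≤ J then Y ω else 0 := by
  classical
  simp only [cutoff, Set.indicator_apply, Set.mem_ofPred_eq]

theorem abs_cutoff_le {Ω : Type*} (J : ℝ) (Y : Ω → ℝ) (ω : Ω) : |cutoff J Y ω| ≤ |Y ω| := by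
  rw [cutoff_apply]
  split_ifs <;> simp

theorem abs_sub_cutoff_le {Ω : Type*} {J : ℝ} (hJ : 0 < J) (Y : Ω → ℝ) (ω : Ω) :
    |Y ω - cutoff J Y ω| ≤ Y ω ^ 2 / J := by
  rw [cutoff_apply]
  split_ifs with h
  · rw [sub_self, abs_zero]; positivity
  · rw [sub_zero, le_div_iff₀ hJ, ← sq_abs, sq]
    exact mul_le_mul_of_nonneg_left (not_le.1 h).le (abs_nonneg _)

section
variable {Ω : Type*} [MeasurableSpace Ω] {P : Measure Ω}

theorem measurable_cutoff {Y : Ω → ℝ} (hY : Measurable Y) (J : ℝ) : Measurable (cutoff J Y) :=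
  hY.indicator (measurableSet_le hY.abs measurable_const)

theorem memLp_cutoff {Y : Ω → ℝ} {p : ENNReal} (hYm : Measurable Y) (hY : MemLp Y p P) (J : ℝ) :
    MemLp (cutoff J Y) p P :=
  hY.mono (measurable_cutoff hYm J).aestronglyMeasurable (ae_of_all _ (abs_cutoff_le J Y))

variable [IsProbabilityMeasure P]

theorem abs_integral_cutoff_le {Y : Ω → ℝ} {D J : ℝ} (hD : 1 ≤ D) (hJ : 0 < J)
    (hYm : Measurable Y) (hY : MemLp Y 4 P) (hYD : ∫ ω, Y ω ^ 4 ∂P ≤ D)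
    (hmean : ∫ ω, Y ω ∂P = 0) : |∫ ω, cutoff J Y ω ∂P| ≤ D / J := by
  have hY1 : Integrable Y P := hY.integrable (by norm_num)
  have hc1 : Integrable (cutoff J Y) P := (memLp_cutoff hYm hY J).integrable (by norm_num)
  have hY2 : Integrable (fun ω => Y ω ^ 2) P :=
    (hY.mono_exponent (q := 4) (p := 2) (by norm_num)).integrable_sq
  -- As `Y` is centered, the mean of the cutoff is minus that of the tail, which is at most `Y² / J`
  -- in absolute value.
  have e : ∫ ω, cutoff J Y ω ∂P = -∫ ω, (Y ω - cutoff J Y ω) ∂P := by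
    rw [integral_sub hY1 hc1, hmean]; ring
  rw [e, abs_neg]
  calc |∫ ω, (Y ω - cutoff J Y ω) ∂P| ≤ ∫ ω, Y ω ^ 2 / J ∂P :=
        (Real.norm_eq_abs _).symm.trans_le (norm_integral_le_of_norm_le (hY2.div_const J)
          (ae_of_all _ fun ω => abs_sub_cutoff_le hJ Y ω))
    _ = (∫ ω, Y ω ^ 2 ∂P) / J := integral_div _ _
    _ ≤ D / J := by
        gcongr
        calc ∫ ω, Y ω ^ 2 ∂P = ∫ ω, (1 * Y ω) ^ 2 ∂P := by simp only [one_mul]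
          _ ≤ D := integral_mul_sq_le_of_pow_four_le (Y := fun _ => 1) (memLp_const 1) hY
            (by simpa using hD) hYD

/-- Truncation at level `J` changes the covariances by `O(1/J)`, uniformly over centered fields
with bounded fourth moments. -/
theorem abs_fieldCov_sub_fieldCov_truncatedField_le {d : ℕ} {X : (Fin d → ℤ) → Ω → ℝ} {D J : ℝ}
    (hD : 1 ≤ D) (hJ : 1 ≤ J) (hXm : ∀ n, Measurable (X n)) (hX : ∀ n, MemLp (X n) 4 P)
    (hXD : ∀ n, ∫ ω, X n ω ^ 4 ∂P ≤ D) (hmean : ∀ n, ∫ ω, X n ω ∂P = 0) (k : Fin d → ℤ) :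
    |fieldCov P X k - fieldCov P (truncatedField P J X) k| ≤ (2 * D + D ^ 2) / J := by
  have hJ0 : 0 < J := zero_lt_one.trans_le hJ
  have hX2 : ∀ n, MemLp (X n) 2 P := fun n => (hX n).mono_exponent (by norm_num)
  have hc2 : ∀ n, MemLp (cutoff J (X n)) 2 P := fun n => memLp_cutoff (hXm n) (hX2 n) J
  have hXX : Integrable (fun ω => X 0 ω * X k ω) P := (hX2 0).integrable_mul (hX2 k)
  have hcc : Integrable (fun ω => cutoff J (X 0) ω * cutoff J (X k) ω) P :=
    (hc2 0).integrable_mul (hc2 k)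
  -- The truncated field is centered by construction, so this is by definition the covariance of the
  -- cutoffs.
  have e1 : fieldCov P (truncatedField P J X) k
      = ∫ ω, cutoff J (X 0) ω * cutoff J (X k) ω ∂P
        - (∫ ω, cutoff J (X 0) ω ∂P) * ∫ ω, cutoff J (X k) ω ∂P := by
    exact covariance_eq_sub (hc2 0) (hc2 k)
  have h1 : |∫ ω, (X 0 ω * X k ω - cutoff J (X 0) ω * cutoff J (X k) ω) ∂P| ≤ 2 * D / J := by
    have i1 := integrable_abs_mul_sq (hX k) (hX 0)
    have i2 := integrable_abs_mul_sq (hX 0) (hX k)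
    calc _ ≤ ∫ ω, (|X k ω| * X 0 ω ^ 2 + |X 0 ω| * X k ω ^ 2) / J ∂P := by
          rw [← Real.norm_eq_abs]
          refine norm_integral_le_of_norm_le ((i1.add i2).div_const J) (ae_of_all _ fun ω => ?_)
          have e : X 0 ω * X k ω - cutoff J (X 0) ω * cutoff J (X k) ω
              = (X 0 ω - cutoff J (X 0) ω) * X k ω
                + cutoff J (X 0) ω * (X k ω - cutoff J (X k) ω) := by ring
          rw [e, Real.norm_eq_abs]
          refine (abs_add_le _ _).trans ?_
          rw [abs_mul, abs_mul]
          calc _ ≤ X 0 ω ^ 2 / J * |X k ω| + |X 0 ω| * (X k ω ^ 2 / J) := by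
                exact add_le_add
                  (mul_le_mul_of_nonneg_right (abs_sub_cutoff_le hJ0 _ _) (abs_nonneg _))
                  (mul_le_mul (abs_cutoff_le _ _ _) (abs_sub_cutoff_le hJ0 _ _) (abs_nonneg _)
                    (abs_nonneg _))
            _ = _ := by ring
      _ = (∫ ω, |X k ω| * X 0 ω ^ 2 ∂P + ∫ ω, |X 0 ω| * X k ω ^ 2 ∂P) / J := by
          rw [integral_div, integral_add i1 i2]
      _ ≤ 2 * D / J := by
          gcongr
          have := integral_abs_mul_sq_le hD (hX k) (hX 0) (hXD k) (hXD 0)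
          have := integral_abs_mul_sq_le hD (hX 0) (hX k) (hXD 0) (hXD k)
          linarith
  have h2 : |(∫ ω, cutoff J (X 0) ω ∂P) * ∫ ω, cutoff J (X k) ω ∂P| ≤ D ^ 2 / J := by
    rw [abs_mul]
    calc _ ≤ D / J * (D / J) := by
          gcongr
          · exact abs_integral_cutoff_le hD hJ0 (hXm 0) (hX 0) (hXD 0) (hmean 0)
          · exact abs_integral_cutoff_le hD hJ0 (hXm k) (hX k) (hXD k) (hmean k)
      _ = D ^ 2 / J * (1 / J) := by ring
      _ ≤ D ^ 2 / J * 1 := by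
          gcongr
          rwa [div_le_one hJ0]
      _ = _ := mul_one _
  rw [integral_sub hXX hcc] at h1
  rw [e1, fieldCov, sub_sub_eq_add_sub, add_sub_right_comm, add_div]
  exact (abs_add_le _ _).trans (add_le_add h1 h2)
end

/-! ### Passage to the limit -/

/-- Exchange of limits: convergence along an approximation that is uniform in the index. -/
theorem tendsto_of_tendsto_of_abs_sub_le_div {r : ℕ → ℝ} {rJ : ℝ → ℕ → ℝ} {g : ℝ → ℝ}
    {l M : ℝ} (hrJ : ∀ J, 0 < J → Tendsto (rJ J) atTop (𝓝 (g J))) (hg : Tendsto g atTop (𝓝 l))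
    (h : ∀ J, 1 ≤ J → ∀ N, |r N - rJ J N| ≤ M / J) : Tendsto r atTop (𝓝 l) := by
  rw [Metric.tendsto_atTop']
  intro ε hε
  have hM : Tendsto (fun J : ℝ => M / J) atTop (𝓝 0) := tendsto_const_nhds.div_atTop tendsto_id
  obtain ⟨J, hJ1, hJM, hJg⟩ := ((eventually_ge_atTop (1 : ℝ)).and
    ((hM.eventually_lt_const (by positivity : 0 < ε / 3)).and
      (hg.eventually (Metric.ball_mem_nhds l (by positivity : 0 < ε / 3))))).exists
  obtain ⟨N₀, hN₀⟩ := Metric.tendsto_atTop'.1 (hrJ J (by linarith)) (ε / 3) (by positivity)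
  refine ⟨N₀, fun N hN => ?_⟩
  have h1 := h J hJ1 N
  have h2 := hN₀ N hN
  rw [Real.dist_eq] at hJg
  rw [Real.dist_eq] at h2 ⊢
  calc |r N - l| = |(r N - rJ J N) + (rJ J N - g J) + (g J - l)| := by congr 1; ring
    _ ≤ |r N - rJ J N| + |rJ J N - g J| + |g J - l| := abs_add_three _ _ _
    _ < ε := by linarith

theorem card_window_le {d N : ℕ} (A : Set (Fin d → ℤ)) :
    ((window N A).card : ℝ) ≤ (2 * (N : ℝ) + 1) ^ d := by
  classical
  rw [← card_box]
  exact_mod_cast Finset.card_filter_le _ _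

theorem mainTheorem2 {d : ℕ} (hd : 1 ≤ d) (m : ℕ)
    {Ω : ℕ → Type*} [∀ N, MeasurableSpace (Ω N)]
    (P : (N : ℕ) → Measure (Ω N)) [∀ N, IsProbabilityMeasure (P N)]
    (X : (N : ℕ) → (Fin d → ℤ) → Ω N → ℝ)
    (hmeas : ∀ N n, Measurable (X N n))
    (hstat : ∀ N, IsStationaryField (P N) (X N))
    (hcent : ∀ N n, ∫ ω, X N n ω ∂(P N) = 0)
    (hdep : ∀ N, IsMDependentField m (P N) (X N))
    (C : ℝ)
    (hmom : ∀ N, MemLp (X N 0) 4 (P N) ∧ ∫ ω, X N 0 ω ^ 4 ∂(P N) < C)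
    (ρ : (Fin d → ℤ) → ℝ)
    (hcov : ∀ N, ∀ k : Fin d → ℤ, ‖k‖ ≤ (m : ℝ) → |fieldCov (P N) (X N) k| ≤ ρ k)
    (γJ : ℝ → (Fin d → ℤ) → ℝ) (γ : (Fin d → ℤ) → ℝ)
    (hγJ : ∀ k : Fin d → ℤ, ∀ J : ℝ, 0 < J →
      Tendsto (fun N : ℕ => fieldCov (P N) (truncatedField (P N) J (X N)) k) atTop (𝓝 (γJ J k)))
    (hγ : ∀ k : Fin d → ℤ, Tendsto (fun J : ℝ => γJ J k) atTop (𝓝 (γ k)))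
    (A : Set (Fin d → ℤ)) (H : (Fin d → ℤ) → ℝ) (hA : IsAsymptoticallyMeasurable A H) :
    0 ≤ ∑ k ∈ box d m, γ k * H k ∧
    TendstoInDistribution (fun N : ℕ => normalizedSum N A (X N)) atTop (id : ℝ → ℝ) P
      (gaussianReal 0 (∑ k ∈ box d m, γ k * H k).toNNReal) := by
  have hX4 : ∀ N n, MemLp (X N n) 4 (P N) := fun N n =>
    ((hstat N).identDistrib n).memLp_iff.2 (hmom N).1
  have hXC : ∀ N n, ∫ ω, X N n ω ^ 4 ∂(P N) ≤ C := fun N n => by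
    have e : ∫ ω, X N n ω ^ 4 ∂(P N) = ∫ ω, X N 0 ω ^ 4 ∂(P N) :=
      (((hstat N).identDistrib n).comp (measurable_id.pow_const 4)).integral_eq
    exact e.trans_le (hmom N).2.le
  have hX2 : ∀ N n, MemLp (X N n) 2 (P N) := fun N n => (hX4 N n).mono_exponent (by norm_num)
  have hC0 : 0 ≤ C := le_trans (integral_nonneg fun ω => by positivity) (hXC 0 0)
  have hr : ∀ k, Tendsto (fun N => fieldCov (P N) (X N) k) atTop (𝓝 (γ k)) := fun k =>
    tendsto_of_tendsto_of_abs_sub_le_div (hγJ k) (hγ k) fun J hJ N =>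
      abs_fieldCov_sub_fieldCov_truncatedField_le (D := 1 + C) (by linarith) hJ (hmeas N) (hX4 N)
        (fun n => (hXC N n).trans (by linarith)) (hcent N) k
  set c : ℕ → ℝ := fun N => (√((2 * (N : ℝ) + 1) ^ d))⁻¹ with hcdef
  have hc0 : ∀ N, 0 ≤ c N := fun N => by positivity
  have hc2 : ∀ N, c N ^ 2 = ((2 * (N : ℝ) + 1) ^ d)⁻¹ := fun N => by
    simp only [hcdef]
    rw [inv_pow, Real.sq_sqrt (by positivity)]
  have hcs : ∀ N, c N ^ 2 * (window N A).card ≤ 1 := fun N => by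
    rw [hc2, inv_mul_le_iff₀ (by positivity), mul_one]
    exact card_window_le A
  -- The place where `d ≥ 1` is needed.
  have hclim : Tendsto c atTop (𝓝 0) := by
    have h1 : Tendsto (fun N : ℕ => 2 * (N : ℝ) + 1) atTop atTop :=
      tendsto_atTop_add_const_right _ _
        (tendsto_natCast_atTop_atTop.const_mul_atTop (by norm_num : (0 : ℝ) < 2))
    exact (Real.tendsto_sqrt_atTop.comp ((tendsto_pow_atTop (by omega)).comp h1)).inv_tendsto_atTop
  have hsum : ∀ N, normalizedSum N A (X N) = fun ω => c N * ∑ a ∈ window N A, X N a ω := fun N => by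
    funext ω
    rw [normalizedSum, div_eq_inv_mul]
  set v : ℕ → ℝ := fun N => c N ^ 2 * ∑ a ∈ window N A,
    ∫ ω, X N a ω * localSum m (window N A) (X N) a ω ∂(P N) with hvdef
  have hv0 : ∀ N, 0 ≤ v N := fun N => mul_nonneg (sq_nonneg _)
    (sum_integral_mul_localSum_nonneg (hX2 N) (hmeas N) (hdep N) (hcent N) _)
  have hvlim : Tendsto v atTop (𝓝 (∑ k ∈ box d m, γ k * H k)) := by
    have e : v = fun N => ∑ k ∈ box d m, fieldCov (P N) (X N) k * overlap N k A := by
      funext N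
      simp only [hvdef]
      rw [hc2, sum_integral_mul_localSum (hX2 N) (hstat N), Finset.mul_sum]
      refine Finset.sum_congr rfl fun k _ => ?_
      rw [overlap]
      ring
    rw [e]
    exact tendsto_finsetSum _ fun k _ => (hr k).mul (hA k)
  have hσ : 0 ≤ ∑ k ∈ box d m, γ k * H k := ge_of_tendsto' hvlim hv0
  refine ⟨hσ, ?_⟩
  have hmeasS : ∀ N, Measurable (normalizedSum N A (X N)) := fun N => by
    rw [hsum]
    have := hmeas N
    fun_prop
  refine ⟨fun N => (hmeasS N).aemeasurable, aemeasurable_id, ?_⟩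
  refine ProbabilityMeasure.tendsto_iff_tendsto_charFun.2 fun t => ?_
  simp only [ProbabilityMeasure.coe_mk, Measure.map_id, charFun_gaussianReal]
  have hchar : ∀ N, charFun ((P N).map (normalizedSum N A (X N))) t
      = ∫ ω, Complex.exp ((t * (c N * ∑ a ∈ window N A, X N a ω) : ℝ) * Complex.I) ∂(P N) := by
    intro N
    rw [charFun_apply_real, integral_map (hmeasS N).aemeasurable
      (Measurable.aestronglyMeasurable (by fun_prop)), hsum]
    simp only [Complex.ofReal_mul]
  simp only [hchar]
  have hgauss : Tendsto (fun N => Complex.exp (-(v N * t ^ 2 / 2 : ℝ))) atTop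
      (𝓝 (Complex.exp (t * (0 : ℝ) * Complex.I
        - ((∑ k ∈ box d m, γ k * H k).toNNReal : ℝ) * t ^ 2 / 2))) := by
    have h1 : Continuous fun x : ℝ => Complex.exp (-(x * t ^ 2 / 2 : ℝ)) := by fun_prop
    have h2 := (h1.tendsto _).comp hvlim
    have e : (t * (0 : ℝ) * Complex.I - (∑ k ∈ box d m, γ k * H k : ℝ) * t ^ 2 / 2 : ℂ)
        = -((∑ k ∈ box d m, γ k * H k) * t ^ 2 / 2 : ℝ) := by
      push_cast
      ring
    rw [Real.coe_toNNReal _ hσ, e]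
    exact h2
  have hdiff : Tendsto (fun N =>
      ∫ ω, Complex.exp ((t * (c N * ∑ a ∈ window N A, X N a ω) : ℝ) * Complex.I) ∂(P N)
        - Complex.exp (-(v N * t ^ 2 / 2 : ℝ))) atTop (𝓝 0) := by
    refine squeeze_zero_norm (fun N => norm_integral_exp_sum_sub_gaussian_le (hmeas N) (hX4 N) hC0
      (hXC N) (hdep N) (hcent N) (window N A) (hc0 N) (hcs N) t) ?_
    -- The bound is `c N` times a factor that converges because `v N` does.
    have h1 := ((Real.continuous_exp.tendsto _).comp
      ((hvlim.mul_const (t ^ 2)).div_const 2)).const_mul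
        (2 * t ^ 2 * (1 + (box d m).card ^ 4 * C)
          + |t| * √((box d (3 * m)).card * (1 + (box d m).card ^ 4 * C)))
    simpa using hclim.mul (h1.mul_const |t|)
  simpa using hdiff.add hgauss
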